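/- Two metric spaces $X$ and $Y$ are called rough isometric if there exist a map $T\colon X\to Y$ and constants $M>0$, $D,R\ge 0$ such that $$\tfrac1M\,d_X(x_1,x_2)-D\le d_Y(T(x_1),T(x_2))\le M\,d_X(x_1,x_2)+D\qquad\text{for all }x_1,x_2\in X,$$ and for every $y\in Y$ there is some $x\in X$ with $d_Y(y,T(x))\le R$. A Poisson process on $\mathbb R$ is viewed as a random locally finite subset of $\mathbb R$ with the metric inherited from $\mathbb R$. A Bernoulli percolation on $\mathbb Z$ with parameter $p$ is the random subset of $\mathbb Z$, with the inherited metric, that contains each integer independently with probability $p$. The following are equivalent: (i) for some intensities $\alpha,\beta>0$, two independent Poisson processes on $\mathbb R$, one with intensity $\alpha$ and the other with intensity $\beta$, are rough isometric almost surely; (ii) for any intensities $\alpha,\beta>0$, two independent Poisson processes on $\mathbb R$, one with intensity $\alpha$ and the other with intensity $\beta$, are rough isometric almost surely; (iii) for some $0<p,q<1$, two independent Bernoulli percolations on $\mathbb Z$, one with parameter $p$ and the other with parameter $q$, are rough isometric almost surely; (iv) for any $0<p,q<1$, two independent Bernoulli percolations on $\mathbb Z$, one with parameter $p$ and the other with parameter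 $q$, are rough isometric almost surely. -/

import Mathlib

open MeasureTheory ProbabilityTheory
open scoped NNReal

/-- `T` is a rough isometry with constants `M, D, R`. The multiplicative constant is required to be
positive, so that the factor `1 / M` is meaningful. -/
structure IsRoughIsometryWith {X Y : Type*} [MetricSpace X] [MetricSpace Y]
    (M D R : ℝ) (T : X → Y) : Prop where
  M_pos : 0 < M
  D_nonneg : 0 ≤ D
  R_nonneg : 0 ≤ R
  lower : ∀ x₁ x₂ : X, 1 / M * dist x₁ x₂ - D ≤ dist (T x₁) (T x₂)
  upper : ∀ x₁ x₂ : X, dist (T x₁) (T x₂) ≤ M * dist x₁ x₂ + D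
  almost_onto : ∀ y : Y, ∃ x : X, dist y (T x) ≤ R

/-- Two metric spaces are rough isometric (quasi-isometric). -/
def RoughIsometric (X Y : Type*) [MetricSpace X] [MetricSpace Y] : Prop :=
  ∃ (T : X → Y) (M D R : ℝ), IsRoughIsometryWith M D R T

/-- A locally finite subset of the real line. -/
structure PointConfig where
  carrier : Set ℝ
  locallyFinite : ∀ a b : ℝ, (carrier ∩ Set.Icc a b).Finite

namespace PointConfig

/-- The number of points of a configuration in `B` (which is finite for bounded `B`). -/
noncomputable def count (B : Set ℝ) (s : PointConfig) : ℕ := (s.carrier ∩ B).ncard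

/-- The usual σ-algebra on point configurations, generated by the counts of points in bounded
Borel sets. -/
noncomputable instance : MeasurableSpace PointConfig :=
  ⨆ (B : Set ℝ) (_ : MeasurableSet B ∧ Bornology.IsBounded B), MeasurableSpace.comap (count B) ⊤

end PointConfig

/-- `A` is a (homogeneous) Poisson process on `ℝ` with intensity `α`, viewed as a random locally
finite subset of `ℝ`: the number of points in a bounded Borel set `B` is Poisson distributed with
mean `α |B|`, and the numbers of points in pairwise disjoint bounded Borel sets are independent. -/
structure IsPoissonProcess {Ω : Type*} [MeasurableSpace Ω] (α : ℝ≥0) (A : Ω → PointConfig)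
    (P : Measure Ω) : Prop where
  measurable : Measurable A
  hasLaw_count : ∀ B : Set ℝ, MeasurableSet B → Bornology.IsBounded B →
    HasLaw (fun ω ↦ (A ω).count B) (poissonMeasure (α * (volume B).toNNReal)) P
  iIndepFun_count : ∀ (n : ℕ) (B : Fin n → Set ℝ), (∀ i, MeasurableSet (B i)) →
    (∀ i, Bornology.IsBounded (B i)) → Pairwise (Function.onFun Disjoint B) →
    iIndepFun (fun i ω ↦ (A ω).count (B i)) P

universe u

/-- Two independent Poisson processes on the line, of intensities `α` and `β`, are almost surely
rough isometric (each with the metric inherited from `ℝ`). -/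
def PoissonRoughIsometricAS (α β : ℝ≥0) : Prop :=
  ∀ (Ω : Type u) [MeasurableSpace Ω] (P : Measure Ω) [IsProbabilityMeasure P]
    (A B : Ω → PointConfig), IsPoissonProcess α A P → IsPoissonProcess β B P →
    IndepFun A B P → ∀ᵐ ω ∂P, RoughIsometric (A ω).carrier (B ω).carrier

/-- Two independent Bernoulli percolations on `ℤ`, with parameters `p` and `q`, are almost surely
rough isometric (each with the metric inherited from `ℤ`). -/
def BernoulliRoughIsometricAS (p q : unitInterval) : Prop :=
  ∀ (Ω : Type u) [MeasurableSpace Ω] (P : Measure Ω) [IsProbabilityMeasure P]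
    (A B : Ω → Set ℤ), IsSetBernoulli A Set.univ p P → IsSetBernoulli B Set.univ q P →
    IndepFun A B P → ∀ᵐ ω ∂P, RoughIsometric (A ω) (B ω)

/-! Cut the line into cells of length `c`. A configuration is rough isometric to the set of cells it
hits (`roughIsometric_floorImage`). For a Poisson process of intensity `α` that set is Bernoulli
percolation with parameter `1 - exp (-α c)` (`IsPoissonProcess.isSetBernoulli_floorImage`), and
varying `c` reaches every parameter in `(0, 1)`. Since rough isometry is an equivalence relation, a
Bernoulli statement for one pair `p, q` gives the Poisson statement for all `α, β`.

The converse starts from percolations on an arbitrary probability space, which may carry no Poisson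
process. A Poisson process is therefore built on the standard Borel space `CellData`, its law is
disintegrated along the set of hit cells, and the resulting kernel enlarges the given space by a
process hitting exactly the given cells. Doing this for both percolations preserves independence,
and Fubini brings the conclusion back. As `CellData` lies in `Type`, the enlarged space stays in
universe `u`. -/

/-! ### Rough isometry is symmetric and transitive. -/

theorem RoughIsometric.symm {X Y : Type*} [MetricSpace X] [MetricSpace Y]
    (h : RoughIsometric X Y) : RoughIsometric Y X := by
  obtain ⟨T, M, D, R, h⟩ := h
  have hM := h.M_pos
  have hD := h.D_nonneg
  have hR := h.R_nonneg
  choose S hS using h.almost_onto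
  have key (y₁ y₂ : Y) : |dist (T (S y₁)) (T (S y₂)) - dist y₁ y₂| ≤ 2 * R := by
    have := abs_dist_sub_le (T (S y₁)) y₁ (T (S y₂))
    have := abs_dist_sub_le (T (S y₂)) y₂ y₁
    have h1 := hS y₁
    have h2 := hS y₂
    rw [dist_comm] at h1 h2
    rw [dist_comm _ y₁, dist_comm y₂ y₁] at this
    simp only [abs_le] at *
    constructor <;> linarith
  -- The lower bound loses `(D + 2R) / M` and the upper bound `(D + 2R) M`; the sum covers both.
  refine ⟨S, M, (D + 2 * R) * (M + 1 / M), M * (D + R), hM, by positivity, by positivity,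
    fun y₁ y₂ ↦ ?_, fun y₁ y₂ ↦ ?_, fun x ↦ ⟨T x, ?_⟩⟩
  · have h1 := h.upper (S y₁) (S y₂)
    have h2 := (abs_le.1 (key y₁ y₂)).1
    have h3 : 1 / M * dist y₁ y₂ ≤ 1 / M * (M * dist (S y₁) (S y₂) + D + 2 * R) := by
      gcongr; linarith
    have h4 : 1 / M * (M * dist (S y₁) (S y₂) + D + 2 * R)
        = dist (S y₁) (S y₂) + (D + 2 * R) * (1 / M) := by field_simp; ring
    have : 0 ≤ (D + 2 * R) * M := by positivity
    linarith
  · have h1 := h.lower (S y₁) (S y₂)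
    have h2 := (abs_le.1 (key y₁ y₂)).2
    have h3 : M * (1 / M * dist (S y₁) (S y₂)) ≤ M * (dist y₁ y₂ + (D + 2 * R)) := by
      gcongr; linarith
    have h4 : M * (1 / M * dist (S y₁) (S y₂)) = dist (S y₁) (S y₂) := by field_simp
    have : 0 ≤ (D + 2 * R) * (1 / M) := by positivity
    linarith
  · have h1 := h.lower x (S (T x))
    have h2 := hS (T x)
    have h3 : M * (1 / M * dist x (S (T x))) ≤ M * (D + R) := by gcongr; linarith
    have h4 : M * (1 / M * dist x (S (T x))) = dist x (S (T x)) := by field_simp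
    linarith

theorem RoughIsometric.trans {X Y Z : Type*} [MetricSpace X] [MetricSpace Y] [MetricSpace Z]
    (h₁ : RoughIsometric X Y) (h₂ : RoughIsometric Y Z) : RoughIsometric X Z := by
  obtain ⟨T, M, D, R, h⟩ := h₁
  obtain ⟨T', M', D', R', h'⟩ := h₂
  have hM := h.M_pos
  have hD := h.D_nonneg
  have hR := h.R_nonneg
  have hM' := h'.M_pos
  have hD' := h'.D_nonneg
  have hR' := h'.R_nonneg
  refine ⟨T' ∘ T, M * M', D * (M' + 1 / M') + D', M' * R + D' + R', by positivity,
    by positivity, by positivity, fun x₁ x₂ ↦ ?_, fun x₁ x₂ ↦ ?_, fun z ↦ ?_⟩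
  · have h1 := h.lower x₁ x₂
    have h2 := h'.lower (T x₁) (T x₂)
    have h3 : 1 / M' * (1 / M * dist x₁ x₂ - D) ≤ 1 / M' * dist (T x₁) (T x₂) := by gcongr
    have h4 : 1 / M' * (1 / M * dist x₁ x₂ - D)
        = 1 / (M * M') * dist x₁ x₂ - D * (1 / M') := by field_simp
    have : 0 ≤ D * M' := by positivity
    simp only [Function.comp_apply]
    linarith
  · have h1 := h.upper x₁ x₂
    have h2 := h'.upper (T x₁) (T x₂)
    have h3 : M' * dist (T x₁) (T x₂) ≤ M' * (M * dist x₁ x₂ + D) := by gcongr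
    have : 0 ≤ D * (1 / M') := by positivity
    simp only [Function.comp_apply]
    linarith
  · obtain ⟨y, hy⟩ := h'.almost_onto z
    obtain ⟨x, hx⟩ := h.almost_onto y
    refine ⟨x, ?_⟩
    have h1 := h'.upper y (T x)
    have h2 := dist_triangle z (T' y) (T' (T x))
    have h3 : M' * dist y (T x) ≤ M' * R := by gcongr
    simp only [Function.comp_apply]
    linarith

/-! ### Discretization into cells. -/

/-- The set of cells of side length `c` hit by a set of reals. -/
def floorImage (c : ℝ) (S : Set ℝ) : Set ℤ := (fun x ↦ ⌊x / c⌋) '' S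

theorem roughIsometric_floorImage {c : ℝ} (hc : 0 < c) (S : Set ℝ) :
    RoughIsometric S (floorImage c S) := by
  -- `c + 1 / c` dominates both `c`, needed below, and `1 / c`, needed above; rounding costs at most
  -- 1.
  refine ⟨fun x ↦ ⟨⌊x.1 / c⌋, x.1, x.2, rfl⟩, c + 1 / c, 1, 0, by positivity, zero_le_one, le_rfl,
    fun x y ↦ ?_, fun x y ↦ ?_, ?_⟩
  rotate_left 2
  · rintro ⟨_, x, hx, rfl⟩
    exact ⟨⟨x, hx⟩, by simp⟩
  all_goals
    have key : |dist (⟨⌊x.1 / c⌋, x.1, x.2, rfl⟩ : floorImage c S) ⟨⌊y.1 / c⌋, y.1, y.2, rfl⟩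
        - dist x y / c| ≤ 1 := by
      rw [Subtype.dist_eq, Subtype.dist_eq, Int.dist_eq, Real.dist_eq,
        show |x.1 - y.1| / c = |x.1 / c - y.1 / c| by
          rw [← sub_div, abs_div, abs_of_pos hc]]
      refine (abs_abs_sub_abs_le _ _).trans (abs_le.2 ?_)
      have := Int.floor_le (x.1 / c)
      have := Int.lt_floor_add_one (x.1 / c)
      have := Int.floor_le (y.1 / c)
      have := Int.lt_floor_add_one (y.1 / c)
      constructor <;> linarith
    rw [abs_le] at key
  · have h1 : 1 / (c + 1 / c) * dist x y ≤ dist x y / c := by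
      rw [div_mul_eq_mul_div, one_mul]
      have : 0 < 1 / c := by positivity
      gcongr
      linarith
    linarith
  · have h1 : (c + 1 / c) * dist x y = c * dist x y + dist x y / c := by ring
    have : 0 ≤ c * dist x y := by positivity
    linarith

theorem PointConfig.measurable_count {B : Set ℝ} (hB : MeasurableSet B)
    (hb : Bornology.IsBounded B) : Measurable (PointConfig.count B) := by
  refine Measurable.of_comap_le ?_
  exact le_iSup₂_of_le (f := fun (B : Set ℝ) (_ : MeasurableSet B ∧ Bornology.IsBounded B) ↦
    MeasurableSpace.comap (PointConfig.count B) ⊤) B ⟨hB, hb⟩ le_rfl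

theorem PointConfig.mem_floorImage_iff {c : ℝ} (hc : 0 < c) (s : PointConfig) (n : ℤ) :
    n ∈ floorImage c s.carrier ↔ s.count (Set.Ico (c * n) (c * (n + 1))) ≠ 0 := by
  -- `ncard` of an infinite set is 0, so a zero count means an empty cell only by local finiteness.
  have hfin : (s.carrier ∩ Set.Ico (c * n) (c * (n + 1))).Finite :=
    (s.locallyFinite _ _).subset (Set.inter_subset_inter_right _ Set.Ico_subset_Icc_self)
  rw [PointConfig.count, Ne, Set.ncard_eq_zero hfin, ← Ne, ← Set.nonempty_iff_ne_empty]
  refine exists_congr fun x ↦ and_congr_right fun _ ↦ ?_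
  simp only [Int.floor_eq_iff, Set.mem_Ico, le_div_iff₀' hc, div_lt_iff₀' hc]

theorem PointConfig.measurable_floorImage {c : ℝ} (hc : 0 < c) :
    Measurable fun s : PointConfig ↦ floorImage c s.carrier := by
  refine measurable_set_iff.2 fun n ↦ ?_
  simp_rw [mem_floorImage_iff hc]
  exact (Measurable.of_discrete (f := fun k : ℕ ↦ k ≠ 0)).comp
    (measurable_count measurableSet_Ico (Metric.isBounded_Ico _ _))

/-! ### From Poisson processes to Bernoulli percolation. -/

theorem map_ne_zero_poissonMeasure {r : ℝ≥0} {p : unitInterval} (h : 1 - (p : ℝ) = Real.exp (-r)) :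
    (poissonMeasure r).map (fun k ↦ k ≠ 0) = unitInterval.toNNReal p • Measure.dirac True
      + unitInterval.toNNReal (unitInterval.symm p) • Measure.dirac False := by
  have hcoe (q : unitInterval) : (unitInterval.toNNReal q : ENNReal) = ENNReal.ofReal q :=
    (ENNReal.ofReal_eq_coe_nnreal q.2.1).symm
  have h0 : poissonMeasure r {0} = unitInterval.toNNReal (unitInterval.symm p) := by
    rw [poissonMeasure_singleton, hcoe, unitInterval.coe_symm_eq, h]
    simp
  have h1 : poissonMeasure r {0}ᶜ = unitInterval.toNNReal p := by
    rw [prob_compl_eq_one_sub (MeasurableSet.singleton 0), h0, hcoe, hcoe, unitInterval.coe_symm_eq,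
      ← ENNReal.ofReal_one, ← ENNReal.ofReal_sub _ (sub_nonneg.2 p.2.2), sub_sub_cancel]
  refine Measure.ext_of_singleton fun q ↦ ?_
  rw [Measure.map_apply .of_discrete .of_discrete]
  by_cases hq : q
  · obtain rfl : q = True := eq_true hq
    have : ((fun k : ℕ ↦ k ≠ 0) ⁻¹' {True}) = {0}ᶜ := by ext; simp
    rw [this, h1]
    rw [Measure.add_apply, Measure.smul_apply, Measure.smul_apply,
      Measure.dirac_apply' _ .of_discrete, Measure.dirac_apply' _ .of_discrete,
      Set.indicator_of_mem, Set.indicator_of_notMem]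
    · simp [ENNReal.smul_def]
    · exact false_ne_true
    · exact rfl
  · obtain rfl : q = False := eq_false hq
    have : ((fun k : ℕ ↦ k ≠ 0) ⁻¹' {False}) = {0} := by ext; simp
    rw [this, h0]
    rw [Measure.add_apply, Measure.smul_apply, Measure.smul_apply,
      Measure.dirac_apply' _ .of_discrete, Measure.dirac_apply' _ .of_discrete,
      Set.indicator_of_notMem, Set.indicator_of_mem]
    · simp [ENNReal.smul_def]
    · exact rfl
    · exact true_ne_false

/-- Counts in distinct cells are independent Poisson variables of mean `α c`, each nonzero with
probability `1 - exp (-α c) = p`. -/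
theorem IsPoissonProcess.isSetBernoulli_floorImage {Ω : Type*} [MeasurableSpace Ω]
    {P : Measure Ω} [IsProbabilityMeasure P] {α : ℝ≥0} {A : Ω → PointConfig}
    (hA : IsPoissonProcess α A P) {c : ℝ} (hc : 0 < c) {p : unitInterval}
    (hp : 1 - (p : ℝ) = Real.exp (-(α * c))) :
    IsSetBernoulli (fun ω ↦ floorImage c (A ω).carrier) Set.univ p P := by
  let cell (n : ℤ) : Set ℝ := Set.Ico (c * n) (c * (n + 1))
  have hcell (n : ℤ) : MeasurableSet (cell n) := measurableSet_Ico
  have hcell' (n : ℤ) : Bornology.IsBounded (cell n) := Metric.isBounded_Ico _ _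
  have hdisj : Pairwise (Function.onFun Disjoint cell) := by
    intro m n hmn
    refine Set.disjoint_left.2 fun x hm hn ↦ hmn ?_
    simp only [cell, Set.mem_Ico, ← le_div_iff₀' hc, ← div_lt_iff₀' hc] at hm hn
    rw [← Int.floor_eq_iff] at hm hn
    exact hm.symm.trans hn
  have hvol (n : ℤ) : volume (cell n) = ENNReal.ofReal c := by
    rw [Real.volume_Ico]
    congr 1
    ring
  have hmem (ω : Ω) (n : ℤ) : n ∈ floorImage c (A ω).carrier ↔ (A ω).count (cell n) ≠ 0 :=
    PointConfig.mem_floorImage_iff hc _ n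
  have hcount : iIndepFun (fun n ω ↦ (A ω).count (cell n)) P := by
    -- Independence is assumed only for families indexed by `Fin n`, so each finite set of cells is
    -- enumerated.
    refine iIndepFun_iff_finset.2 fun s ↦ ?_
    have := hA.iIndepFun_count s.card (fun i ↦ cell (s.equivFin.symm i)) (fun i ↦ hcell _)
      (fun i ↦ hcell' _) fun i j hij ↦ hdisj fun h ↦ hij (s.equivFin.symm.injective (Subtype.ext h))
    exact iIndepFun.of_precomp s.equivFin.symm.surjective this
  have hind : iIndepFun (fun (n : ℤ) ω ↦ n ∈ floorImage c (A ω).carrier) P := by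
    simp_rw [hmem]
    exact hcount.comp (fun _ k ↦ k ≠ 0) fun _ ↦ .of_discrete
  have hlaw (n : ℤ) : HasLaw (fun ω ↦ n ∈ floorImage c (A ω).carrier)
      (unitInterval.toNNReal p • Measure.dirac (n ∈ (Set.univ : Set ℤ))
        + unitInterval.toNNReal (unitInterval.symm p) • Measure.dirac False) P := by
    simp_rw [hmem, Set.mem_univ]
    refine HasLaw.fun_comp (Y := fun k ↦ k ≠ 0) ⟨Measurable.of_discrete.aemeasurable, ?_⟩
      (hA.hasLaw_count (cell n) (hcell n) (hcell' n))
    rw [hvol]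
    refine map_ne_zero_poissonMeasure ?_
    rwa [NNReal.coe_mul, ENNReal.coe_toNNReal_eq_toReal, ENNReal.toReal_ofReal hc.le]
  have hpi := hind.hasLaw_infinitePi hlaw ?_
  · refine HasLaw.fun_comp (Y := fun q : ℤ → Prop ↦ {i | q i}) ⟨?_, ?_⟩ hpi
    · exact MeasurableEquiv.setOfPred.measurable.aemeasurable
    · exact (setBernoulli_eq_map _ _).symm
  · refine (measurable_pi_iff.2 fun n ↦ ?_).aemeasurable
    exact measurable_set_iff.1 ((PointConfig.measurable_floorImage hc).comp hA.measurable) n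

theorem exists_one_sub_eq_exp {α : ℝ≥0} (hα : 0 < α) {p : unitInterval} (hp : 0 < p ∧ p < 1) :
    ∃ c : ℝ, 0 < c ∧ 1 - (p : ℝ) = Real.exp (-(α * c)) := by
  have h0 : (0 : ℝ) < p := hp.1
  have h1 : (p : ℝ) < 1 := hp.2
  have hα' : (0 : ℝ) < α := hα
  refine ⟨-Real.log (1 - p) / α, div_pos (neg_pos.2 (Real.log_neg (by linarith) (by linarith)))
    hα', ?_⟩
  rw [mul_div_cancel₀ _ hα'.ne', neg_neg, Real.exp_log (by linarith)]

/-- A Poisson process remains one on an extension of the probability space. -/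
theorem IsPoissonProcess.comp_hasLaw {Ω Ω' : Type*} [MeasurableSpace Ω] [MeasurableSpace Ω']
    {P : Measure Ω} {Q : Measure Ω'} [IsProbabilityMeasure P] [IsProbabilityMeasure Q] {α : ℝ≥0}
    {A : Ω → PointConfig} (hA : IsPoissonProcess α A P) {f : Ω' → Ω} (hf : Measurable f)
    (hfP : Q.map f = P) : IsPoissonProcess α (fun x ↦ A (f x)) Q := by
  refine ⟨hA.measurable.comp hf, fun B hm hb ↦ ?_, fun n B hm hb hd ↦ ?_⟩
  · exact (hA.hasLaw_count B hm hb).fun_comp ⟨hf.aemeasurable, hfP⟩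
  · have h := hA.iIndepFun_count n B hm hb hd
    have hmeas (i : Fin n) : Measurable fun ω ↦ (A ω).count (B i) :=
      (PointConfig.measurable_count (hm i) (hb i)).comp hA.measurable
    subst hfP
    rw [iIndepFun_iff_map_fun_eq_pi_map fun i ↦ (hmeas i).aemeasurable] at h
    refine (iIndepFun_iff_map_fun_eq_pi_map fun i ↦ ((hmeas i).comp hf).aemeasurable).2 ?_
    rw [Measure.map_map (measurable_pi_lambda _ hmeas) hf] at h
    simp only [Measure.map_map (hmeas _) hf] at h
    exact h

theorem PoissonRoughIsometricAS.of_bernoulli {α β : ℝ≥0} (hα : 0 < α) (hβ : 0 < β)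
    {p q : unitInterval} (hp : 0 < p ∧ p < 1) (hq : 0 < q ∧ q < 1)
    (h : BernoulliRoughIsometricAS.{u} p q) : PoissonRoughIsometricAS.{u} α β := by
  obtain ⟨c, hc, hpc⟩ := exists_one_sub_eq_exp hα hp
  obtain ⟨d, hd, hqd⟩ := exists_one_sub_eq_exp hβ hq
  intro Ω _ P _ A B hA hB hAB
  have := h Ω P _ _ (hA.isSetBernoulli_floorImage hc hpc) (hB.isSetBernoulli_floorImage hd hqd)
    (hAB.comp (PointConfig.measurable_floorImage hc) (PointConfig.measurable_floorImage hd))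
  filter_upwards [this] with ω hω
  exact ((roughIsometric_floorImage hc _).trans hω).trans (roughIsometric_floorImage hd _).symm

/-! ### A Poisson process on a standard Borel space. -/

/-- The uniform distribution on the unit interval with left end point `n`. -/
noncomputable def unifCell (n : ℤ) : Measure ℝ := volume.restrict (Set.Ico (n : ℝ) (n + 1))

instance (n : ℤ) : IsProbabilityMeasure (unifCell n) := ⟨by simp [unifCell]⟩

instance (n : ℤ) : NullSingletonClass (unifCell n) := by unfold unifCell; infer_instance

/-- The law of a Poisson number of points with mean `α`, together with a sequence of independent
uniform points in the `n`-th unit cell. -/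
noncomputable def cellLaw (α : ℝ≥0) (n : ℤ) : Measure (ℕ × (ℕ → ℝ)) :=
  (poissonMeasure α).prod (Measure.infinitePi fun _ ↦ unifCell n)

instance (α : ℝ≥0) (n : ℤ) : IsProbabilityMeasure (cellLaw α n) := by
  unfold cellLaw; infer_instance

/-- The space of cell data: in each unit cell, a number of points and a sequence of positions. -/
abbrev CellData : Type := ℤ → ℕ × (ℕ → ℝ)

/-- The law of independent cell data in all the unit cells. -/
noncomputable def cellDataLaw (α : ℝ≥0) : Measure CellData := Measure.infinitePi (cellLaw α)

instance (α : ℝ≥0) : IsProbabilityMeasure (cellDataLaw α) := by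
  unfold cellDataLaw; infer_instance

namespace CellData

/-- All positions are in their cell and are distinct. -/
def IsRegular (e : CellData) : Prop :=
  ∀ n : ℤ, (∀ k, (e n).2 k ∈ Set.Ico (n : ℝ) (n + 1)) ∧ ∀ k l, k ≠ l → (e n).2 k ≠ (e n).2 l

theorem measurable_isRegular : Measurable IsRegular := by
  unfold IsRegular
  refine Measurable.forall fun n ↦ Measurable.and (Measurable.forall fun k ↦ ?_)
    (Measurable.forall fun k ↦ Measurable.forall fun l ↦ Measurable.imp measurable_const
      (Measurable.not ?_))
  · exact measurableSet_setOfPred.1 (measurableSet_Ico.preimage (by fun_prop))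
  · exact measurableSet_setOfPred.1 (measurableSet_eq_fun (by fun_prop) (by fun_prop))

theorem ae_isRegular (α : ℝ≥0) : ∀ᵐ e ∂cellDataLaw α, IsRegular e := by
  refine ae_all_iff.2 fun n ↦ ?_
  suffices h : ∀ᵐ u ∂(Measure.infinitePi fun _ : ℕ ↦ unifCell n),
      (∀ k, u k ∈ Set.Ico (n : ℝ) (n + 1)) ∧ ∀ k l, k ≠ l → u k ≠ u l from
    (measurePreserving_eval_infinitePi (cellLaw α) n).quasiMeasurePreserving.ae
      (Measure.quasiMeasurePreserving_snd.ae h)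
  refine (ae_all_iff.2 fun k ↦ ?_).and (ae_all_iff.2 fun k ↦ ae_all_iff.2 fun l ↦ ?_)
  · exact (measurePreserving_eval_infinitePi (fun _ ↦ unifCell n) k).quasiMeasurePreserving.ae
      (ae_restrict_mem measurableSet_Ico)
  · by_cases hkl : k = l
    · simp [hkl]
    · have hd : ∀ᵐ x ∂(unifCell n).prod (unifCell n), x.1 ≠ x.2 := by
        refine (Measure.ae_prod_iff_ae_ae (p := fun x : ℝ × ℝ ↦ x.1 ≠ x.2)
          (measurableSet_eq_fun measurable_fst measurable_snd).compl).2 ?_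
        exact ae_of_all _ fun x ↦ (Measure.ae_ne _ x).mono fun _ ↦ Ne.symm
      rw [← Measure.infinitePi_map_eval_prod (P := fun _ : ℕ ↦ unifCell n) hkl] at hd
      filter_upwards [ae_of_ae_map (by fun_prop) hd] with u hu _
      exact hu

/-- The random points. -/
def points (e : CellData) : Set ℝ := {x | ∃ n, ∃ k < (e n).1, (e n).2 k = x}

/-- The number of random points of a cell which are in `B`. -/
noncomputable def cellCount (B : Set ℝ) (s : ℕ × (ℕ → ℝ)) : ℕ :=
  ∑ k ∈ Finset.range s.1, B.indicator 1 (s.2 k)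

theorem measurable_cellCount {B : Set ℝ} (hB : MeasurableSet B) :
    Measurable (cellCount B) := by
  refine measurable_from_prod_countable_right fun N ↦ ?_
  change Measurable fun u : ℕ → ℝ ↦ ∑ k ∈ Finset.range N, B.indicator 1 (u k)
  exact Finset.measurable_sum _ fun k _ ↦
    ((measurable_one : Measurable (1 : ℝ → ℕ)).indicator hB).comp (measurable_pi_apply k)

theorem IsRegular.points_inter_eq {e : CellData} (he : IsRegular e) {m : ℕ} {B : Set ℝ}
    (hB : B ⊆ Set.Ico (-m : ℝ) m) [DecidablePred (· ∈ B)] :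
    points e ∩ B = (((Finset.Ico (-m : ℤ) m).sigma fun n ↦
      (Finset.range (e n).1).filter fun k ↦ (e n).2 k ∈ B).image fun x ↦ (e x.1).2 x.2 :
        Finset ℝ) := by
  ext x
  simp only [points, Set.mem_inter_iff, Set.mem_ofPred_eq, Finset.coe_image, Set.mem_image,
    Finset.mem_coe, Finset.mem_sigma, Finset.mem_filter, Finset.mem_range, Finset.mem_Ico]
  constructor
  · rintro ⟨⟨n, k, hk, rfl⟩, hx⟩
    refine ⟨⟨n, k⟩, ⟨?_, hk, hx⟩, rfl⟩
    have h1 := hB hx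
    have h2 := (he n).1 k
    simp only [Set.mem_Ico] at h1 h2
    dsimp only
    constructor
    · have : (-m : ℝ) < n + 1 := h1.1.trans_lt h2.2
      have : (-m : ℤ) < n + 1 := by exact_mod_cast this
      omega
    · exact_mod_cast h2.1.trans_lt h1.2
  · rintro ⟨⟨n, k⟩, ⟨-, hk, hx⟩, rfl⟩
    exact ⟨⟨n, k, hk, rfl⟩, hx⟩

/-- No point is counted twice: the floor of a position recovers its cell, and positions within a
cell are distinct. -/
theorem IsRegular.ncard_points_inter {e : CellData} (he : IsRegular e) {m : ℕ} {B : Set ℝ}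
    (hB : B ⊆ Set.Ico (-m : ℝ) m) :
    (points e ∩ B).ncard = ∑ n ∈ Finset.Ico (-m : ℤ) m, cellCount B (e n) := by
  classical
  rw [he.points_inter_eq hB, Set.ncard_coe_finset, Finset.card_image_of_injective, Finset.card_sigma]
  · simp only [cellCount, Finset.card_filter, Set.indicator_apply, Pi.one_apply]
  · rintro ⟨n, k⟩ ⟨n', k'⟩ (h : (e n).2 k = (e n').2 k')
    have h1 := (he n).1 k
    have h2 := (he n').1 k'
    rw [← h] at h2
    obtain rfl : n = n' := (Int.floor_eq_iff.2 h1).symm.trans (Int.floor_eq_iff.2 h2)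
    have : k = k' := by_contra fun hk ↦ (he n).2 k k' hk h
    rw [this]

open Classical in
/-- The random points as a point configuration. -/
noncomputable def config (e : CellData) : PointConfig where
  -- Irregular data form a null set; the value `∅` there ensures local finiteness everywhere.
  carrier := if IsRegular e then points e else ∅
  locallyFinite a b := by
    split_ifs with he
    · obtain ⟨m, hm⟩ := exists_nat_gt (max |a| |b|)
      have ha := neg_abs_le a
      have hb := le_abs_self b
      have h1 := le_max_left |a| |b|
      have h2 := le_max_right |a| |b|
      rw [he.points_inter_eq (m := m) fun x hx ↦ ⟨by linarith [hx.1], by linarith [hx.2]⟩]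
      exact Finset.finite_toSet _
    · simp

theorem IsRegular.count_config {e : CellData} (he : IsRegular e) {m : ℕ} {B : Set ℝ}
    (hB : B ⊆ Set.Ico (-m : ℝ) m) :
    (config e).count B = ∑ n ∈ Finset.Ico (-m : ℤ) m, cellCount B (e n) := by
  rw [← he.ncard_points_inter hB, PointConfig.count, config]
  simp [he]

theorem exists_subset_Ico {B : Set ℝ} (hB : Bornology.IsBounded B) :
    ∃ m : ℕ, B ⊆ Set.Ico (-m : ℝ) m := by
  obtain ⟨r, hr⟩ := hB.subset_closedBall 0
  obtain ⟨m, hm⟩ := exists_nat_gt r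
  refine ⟨m, fun x hx ↦ ?_⟩
  have := hr hx
  rw [mem_closedBall_zero_iff, Real.norm_eq_abs, abs_le] at this
  exact ⟨by linarith, by linarith⟩

theorem measurable_config : Measurable config := by
  refine measurable_iff_comap_le.2 ?_
  simp only [PointConfig.instMeasurableSpace, MeasurableSpace.comap_iSup, MeasurableSpace.comap_comp]
  refine iSup₂_le fun B hB ↦ measurable_iff_comap_le.1 ?_
  obtain ⟨m, hm⟩ := exists_subset_Ico hB.2
  classical
  have : PointConfig.count B ∘ config = fun e ↦
      if IsRegular e then ∑ n ∈ Finset.Ico (-m : ℤ) m, cellCount B (e n) else 0 := by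
    ext e
    split_ifs with he
    · exact he.count_config hm
    · simp [PointConfig.count, config, he]
  rw [this]
  refine Measurable.ite measurable_isRegular.setOf ?_ measurable_const
  exact Finset.measurable_sum _ fun n _ ↦ (measurable_cellCount hB.1).comp (measurable_pi_apply n)

end CellData

/-! ### Characteristic functions of the counts. -/

theorem integral_infinitePi_prod {ι : Type*} {X : ι → Type*} [∀ i, MeasurableSpace (X i)]
    (μ : ∀ i, Measure (X i)) [∀ i, IsProbabilityMeasure (μ i)] (s : Finset ι)
    {f : ∀ i, X i → ℂ} (hf : ∀ i, Measurable (f i)) :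
    ∫ x, ∏ i ∈ s, f i (x i) ∂Measure.infinitePi μ = ∏ i ∈ s, ∫ x, f i x ∂μ i := by
  have hm : Measurable fun y : ∀ i : s, X i ↦ ∏ i : s, f i (y i) :=
    Finset.measurable_fun_prod _ fun i _ ↦ (hf i.1).comp (measurable_pi_apply i)
  have h := integral_restrict_infinitePi (μ := μ) (s := s) (f := fun y ↦ ∏ i : s, f i (y i))
    hm.aestronglyMeasurable
  rw [integral_fintype_prod_eq_prod (fun i : s ↦ f i), Finset.prod_coe_sort s
    (fun i ↦ ∫ x, f i x ∂μ i)] at h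
  rw [← h]
  congr with x
  exact (Finset.prod_coe_sort s (fun i ↦ f i (x i))).symm

theorem integral_pow_poissonMeasure (r : ℝ≥0) (w : ℂ) :
    ∫ k, w ^ k ∂poissonMeasure r = Complex.exp (r * (w - 1)) := by
  rw [integral_poissonMeasure]
  calc ∑' k : ℕ, (Real.exp (-r) * r ^ k / k.factorial) • w ^ k
  _ = ∑' k : ℕ, (Real.exp (-r) : ℂ) * ((r * w) ^ k / k.factorial) := by
      congr with k
      rw [Complex.real_smul]
      push_cast
      ring
  _ = Real.exp (-r) * Complex.exp (r * w) := by
      rw [tsum_mul_left, (NormedSpace.expSeries_div_hasSum_exp (r * w : ℂ)).tsum_eq,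
        Complex.exp_eq_exp_ℂ]
  _ = Complex.exp (r * (w - 1)) := by
      rw [Complex.ofReal_exp, ← Complex.exp_add]
      push_cast
      ring_nf

theorem measurable_prod_range {g : ℝ → ℂ} (hg : Measurable g) :
    Measurable fun s : ℕ × (ℕ → ℝ) ↦ ∏ k ∈ Finset.range s.1, g (s.2 k) := by
  refine measurable_from_prod_countable_right fun N ↦ ?_
  change Measurable fun u : ℕ → ℝ ↦ ∏ k ∈ Finset.range N, g (u k)
  exact Finset.measurable_fun_prod _ fun k _ ↦ hg.comp (measurable_pi_apply k)

/-- Given the number `N` of points, the expectation is the `N`-th power of the mean of `g`;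
averaging over `N` is the Poisson generating function. -/
theorem integral_cellLaw_prod (α : ℝ≥0) (n : ℤ) {g : ℝ → ℂ} (hg : Measurable g)
    (hg1 : ∀ x, ‖g x‖ ≤ 1) :
    ∫ s, ∏ k ∈ Finset.range s.1, g (s.2 k) ∂cellLaw α n
      = Complex.exp (α * (∫ x, g x ∂unifCell n - 1)) := by
  have hi : Integrable (fun s : ℕ × (ℕ → ℝ) ↦ ∏ k ∈ Finset.range s.1, g (s.2 k)) (cellLaw α n) := by
    refine Integrable.of_bound (measurable_prod_range hg).aestronglyMeasurable 1
      (ae_of_all _ fun s ↦ ?_)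
    rw [norm_prod]
    exact Finset.prod_le_one (fun _ _ ↦ norm_nonneg _) fun _ _ ↦ hg1 _
  rw [cellLaw] at hi ⊢
  rw [integral_prod _ hi]
  simp only [integral_infinitePi_prod (fun _ : ℕ ↦ unifCell n) _ (fun _ ↦ hg), Finset.prod_const,
    Finset.card_range]
  exact integral_pow_poissonMeasure _ _

section

variable {ι : Type*} [Fintype ι] {B : ι → Set ℝ}

theorem prod_exp_indicator (t : ι → ℝ) (s : ℕ × (ℕ → ℝ)) :
    ∏ k ∈ Finset.range s.1, Complex.exp ((∑ j, t j * (B j).indicator 1 (s.2 k) : ℝ) * Complex.I)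
      = Complex.exp ((∑ j, t j * (CellData.cellCount (B j) s : ℝ) : ℝ) * Complex.I) := by
  rw [← Complex.exp_sum, ← Finset.sum_mul, ← Complex.ofReal_sum, Finset.sum_comm]
  simp only [← Finset.mul_sum]
  congr! 6 with j
  simp only [CellData.cellCount, Nat.cast_sum]
  refine Finset.sum_congr rfl fun k _ ↦ ?_
  by_cases h : s.2 k ∈ B j <;> simp [h]

/-- A point lies in at most one `B j`, so the exponential is affine in the indicators. -/
theorem exp_sum_indicator (hd : Pairwise (Function.onFun Disjoint B)) (t : ι → ℝ) (x : ℝ) :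
    Complex.exp ((∑ j, t j * (B j).indicator 1 x : ℝ) * Complex.I)
      = 1 + ∑ j, (B j).indicator (fun _ ↦ Complex.exp (t j * Complex.I) - 1) x := by
  by_cases h : ∃ i, x ∈ B i
  · obtain ⟨i, hi⟩ := h
    have hne (j : ι) (hj : j ≠ i) : x ∉ B j := fun h ↦ Set.disjoint_left.1 (hd hj) h hi
    rw [Finset.sum_eq_single i (fun j _ hj ↦ by simp [hne j hj]) (by simp),
      Finset.sum_eq_single i (fun j _ hj ↦ by simp [hne j hj]) (by simp)]
    simp [hi]
  · push Not at h
    simp [h]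

theorem integral_exp_sum_indicator (hm : ∀ j, MeasurableSet (B j))
    (hd : Pairwise (Function.onFun Disjoint B)) (t : ι → ℝ) (μ : Measure ℝ)
    [IsProbabilityMeasure μ] :
    ∫ x, Complex.exp ((∑ j, t j * (B j).indicator 1 x : ℝ) * Complex.I) ∂μ
      = 1 + ∑ j, μ.real (B j) * (Complex.exp (t j * Complex.I) - 1) := by
  simp_rw [exp_sum_indicator hd]
  have hi (j : ι) : Integrable
      ((B j).indicator (fun _ ↦ Complex.exp (t j * Complex.I) - 1)) μ :=
    (integrable_const _).indicator (hm j)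
  rw [integral_add (integrable_const _) (integrable_finsetSum _ fun j _ ↦ hi j),
    integral_finsetSum _ fun j _ ↦ hi j]
  simp [integral_indicator_const _ (hm _)]

end

theorem sum_unifCell_real {m : ℕ} {B : Set ℝ} (hB : MeasurableSet B)
    (hBm : B ⊆ Set.Ico (-m : ℝ) m) :
    ∑ n ∈ Finset.Ico (-m : ℤ) m, (unifCell n).real B = volume.real B := by
  have hU : B = ⋃ n ∈ Finset.Ico (-m : ℤ) m, B ∩ Set.Ico (n : ℝ) (n + 1) := by
    ext x
    simp only [Set.mem_iUnion, Set.mem_inter_iff, exists_prop]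
    refine ⟨fun hx ↦ ⟨⌊x⌋, ?_, hx, Int.floor_le x, Int.lt_floor_add_one x⟩, fun ⟨_, _, hx, _⟩ ↦ hx⟩
    have := hBm hx
    rw [Finset.mem_Ico, Int.le_floor, Int.floor_lt]
    exact_mod_cast this
  conv_rhs => rw [hU]
  rw [measureReal_biUnion_finset ?_ ?_ ?_]
  · refine Finset.sum_congr rfl fun n _ ↦ ?_
    rw [unifCell, measureReal_restrict_apply hB]
  · intro a _ b _ hab
    refine Set.disjoint_left.2 fun x ha hb ↦ hab ?_
    exact (Int.floor_eq_iff.2 ha.2).symm.trans (Int.floor_eq_iff.2 hb.2)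
  · exact fun n _ ↦ hB.inter measurableSet_Ico
  · exact fun n _ ↦ ((measure_mono Set.inter_subset_right).trans_lt measure_Ico_lt_top).ne

namespace CellData

/-- Cells are independent, so their exponents add up, and the masses of `B j` in the cells sum to
its volume. The factorization over `j` yields both the Poisson laws and the independence of the
counts. -/
theorem integral_exp_count_config (α : ℝ≥0) {ι : Type*} [Fintype ι] {B : ι → Set ℝ}
    (hm : ∀ j, MeasurableSet (B j)) (hb : ∀ j, Bornology.IsBounded (B j))
    (hd : Pairwise (Function.onFun Disjoint B)) (t : ι → ℝ) :
    ∫ e, Complex.exp ((∑ j, t j * ((config e).count (B j) : ℝ) : ℝ) * Complex.I) ∂cellDataLaw α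
      = ∏ j, Complex.exp (α * volume.real (B j) * (Complex.exp (t j * Complex.I) - 1)) := by
  obtain ⟨m, hUm⟩ := exists_subset_Ico (Bornology.isBounded_iUnion.2 hb)
  have hBm (j : ι) : B j ⊆ Set.Ico (-m : ℝ) m := (Set.subset_iUnion B j).trans hUm
  let g (x : ℝ) : ℂ := Complex.exp ((∑ j, t j * (B j).indicator 1 x : ℝ) * Complex.I)
  have hg : Measurable g := by
    have : Measurable fun x ↦ ∑ j, t j * (B j).indicator (1 : ℝ → ℝ) x :=
      Finset.measurable_sum _ fun j _ ↦ (measurable_one.indicator (hm j)).const_mul _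
    fun_prop
  have hg1 (x : ℝ) : ‖g x‖ ≤ 1 := (Complex.norm_exp_ofReal_mul_I _).le
  calc
    _ = ∫ e, ∏ n ∈ Finset.Ico (-m : ℤ) m, ∏ k ∈ Finset.range (e n).1, g ((e n).2 k)
        ∂cellDataLaw α := by
      refine integral_congr_ae ?_
      filter_upwards [ae_isRegular α] with e he
      simp only [g, prod_exp_indicator t, he.count_config (hBm _)]
      rw [← Complex.exp_sum, ← Finset.sum_mul, ← Complex.ofReal_sum, Finset.sum_comm]
      simp only [← Finset.mul_sum, Nat.cast_sum]
    _ = ∏ n ∈ Finset.Ico (-m : ℤ) m, Complex.exp (α * (∫ x, g x ∂unifCell n - 1)) := by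
      rw [cellDataLaw, integral_infinitePi_prod (cellLaw α) _ 
        (fun _ ↦ measurable_prod_range hg)]
      simp only [integral_cellLaw_prod α _ hg hg1]
    _ = _ := by
      simp only [g, integral_exp_sum_indicator hm hd, add_sub_cancel_left]
      rw [← Complex.exp_sum, ← Complex.exp_sum, ← Finset.mul_sum, Finset.sum_comm, Finset.mul_sum]
      congr 1
      refine Finset.sum_congr rfl fun j _ ↦ ?_
      rw [← Finset.sum_mul, ← Complex.ofReal_sum, sum_unifCell_real (hm j) (hBm j), mul_assoc]

theorem charFun_map_count_config (α : ℝ≥0) {B : Set ℝ} (hm : MeasurableSet B)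
    (hb : Bornology.IsBounded B) (t : ℝ) :
    charFun ((cellDataLaw α).map fun e ↦ ((config e).count B : ℝ)) t
      = Complex.exp (α * volume.real B * (Complex.exp (t * Complex.I) - 1)) := by
  have h := integral_exp_count_config α (fun _ : Unit ↦ hm) (fun _ ↦ hb)
    (fun a b hab ↦ (hab rfl).elim) (fun _ ↦ t)
  rw [charFun_apply_real, integral_map _ (by fun_prop)]
  · simpa using h
  · exact (measurable_from_nat.comp
      ((PointConfig.measurable_count hm hb).comp measurable_config)).aemeasurable

theorem isPoissonProcess_config (α : ℝ≥0) : IsPoissonProcess α config (cellDataLaw α) := by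
  have hcount {B : Set ℝ} (hm : MeasurableSet B) (hb : Bornology.IsBounded B) :
      Measurable fun e ↦ (config e).count B :=
    (PointConfig.measurable_count hm hb).comp measurable_config
  have hcast {B : Set ℝ} (hm : MeasurableSet B) (hb : Bornology.IsBounded B) :
      Measurable fun e ↦ ((config e).count B : ℝ) :=
    (measurable_from_nat (f := fun k : ℕ ↦ (k : ℝ))).comp (hcount hm hb)
  refine ⟨measurable_config, fun B hm hb ↦ ⟨(hcount hm hb).aemeasurable, ?_⟩,
    fun n B hm hb hd ↦ ?_⟩
  · apply (MeasurableEmbedding.natCast (α := ℝ)).map_injective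
    rw [Measure.map_map (by fun_prop) (hcount hm hb)]
    have : IsProbabilityMeasure ((cellDataLaw α).map fun e ↦ ((config e).count B : ℝ)) :=
      Measure.isProbabilityMeasure_map (hcast hm hb).aemeasurable
    refine Measure.ext_of_charFun (funext fun t ↦ ?_)
    rw [charFun_map_cast_poissonMeasure]
    refine (charFun_map_count_config α hm hb t).trans ?_
    simp [measureReal_def, ENNReal.coe_toNNReal_eq_toReal]
  · have h : iIndepFun (fun i e ↦ ((config e).count (B i) : ℝ)) (cellDataLaw α) := by
      rw [iIndepFun_iff_charFun_pi fun i ↦ (hcast (hm i) (hb i)).aemeasurable]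
      intro t
      simp only [charFun_map_count_config α (hm _) (hb _)]
      rw [← integral_exp_count_config α hm hb hd, charFun_apply, integral_map _ (by fun_prop)]
      · congr with e
      · exact ((WithLp.measurable_toLp 2 _).comp
          (measurable_pi_lambda _ fun i ↦ hcast (hm i) (hb i))).aemeasurable
    -- The floor turns the real-valued counts back into natural numbers.
    have := h.comp (fun _ x ↦ ⌊x⌋₊) fun _ ↦ Nat.measurable_floor
    simpa [Function.comp_def] using this

end CellData

/-! ### Enlarging a probability space by a Poisson process with prescribed hit cells. -/

theorem measurableSet_eq_floorImage {c : ℝ} (hc : 0 < c) :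
    MeasurableSet {x : Set ℤ × CellData | x.1 = floorImage c x.2.config.carrier} := by
  have h := measurable_set_iff.1
    ((PointConfig.measurable_floorImage hc).comp CellData.measurable_config)
  have h' := measurable_set_iff.1 (measurable_id (α := Set ℤ))
  simp only [Set.ext_iff]
  refine measurableSet_setOfPred.2 (Measurable.forall fun n ↦ Measurable.iff ?_ ?_)
  · exact (h' n).comp measurable_fst
  · exact (h n).comp measurable_snd

theorem measurable_floorImage_prodMk {c : ℝ} (hc : 0 < c) :
    Measurable fun e : CellData ↦ (floorImage c e.config.carrier, e) :=
  ((PointConfig.measurable_floorImage hc).comp CellData.measurable_config).prodMk measurable_id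

/-- The conditional law of the cell data of a Poisson process given the set of cells of side length
`c` which it hits. -/
noncomputable def cellDataKernel (α : ℝ≥0) (c : ℝ) : Kernel (Set ℤ) CellData :=
  condDistrib id (fun e : CellData ↦ floorImage c e.config.carrier) (cellDataLaw α)

instance (α : ℝ≥0) (c : ℝ) : IsMarkovKernel (cellDataKernel α c) := by
  unfold cellDataKernel; infer_instance

theorem setBernoulli_compProd_cellDataKernel {α : ℝ≥0} {c : ℝ} (hc : 0 < c) {p : unitInterval}
    (hp : 1 - (p : ℝ) = Real.exp (-(α * c))) :
    setBernoulli Set.univ p ⊗ₘ cellDataKernel α c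
      = (cellDataLaw α).map fun e ↦ (floorImage c e.config.carrier, e) := by
  rw [← ((CellData.isPoissonProcess_config α).isSetBernoulli_floorImage hc hp).map_eq,
    cellDataKernel, compProd_map_condDistrib aemeasurable_id]
  rfl

section

variable {Ω : Type*} [MeasurableSpace Ω] {P : Measure Ω} [IsProbabilityMeasure P]
  {A : Ω → Set ℤ} (hA : Measurable A) {α : ℝ≥0} {c : ℝ}

/-- The joint law of a sample and of cell data drawn from the conditional law given that the cells
hit are those of `A`. -/
noncomputable def poissonExtension (P : Measure Ω) (hA : Measurable A) (α : ℝ≥0) (c : ℝ) :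
    Measure (Ω × CellData) :=
  P ⊗ₘ (cellDataKernel α c).comap A hA

instance : IsProbabilityMeasure (poissonExtension P hA α c) := by
  unfold poissonExtension; infer_instance

theorem map_fst_poissonExtension : (poissonExtension P hA α c).map Prod.fst = P :=
  Measure.fst_compProd _ _

theorem map_prodMap_poissonExtension :
    (poissonExtension P hA α c).map (Prod.map A id) = P.map A ⊗ₘ cellDataKernel α c := by
  ext s hs
  rw [Measure.map_apply (by fun_prop) hs, poissonExtension,
    Measure.compProd_apply (hs.preimage (by fun_prop)), Measure.compProd_apply hs,
    lintegral_map (Kernel.measurable_kernel_prodMk_left hs) hA]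
  rfl

theorem hasLaw_poissonExtension {p : unitInterval} (hAp : IsSetBernoulli A Set.univ p P) (hc : 0 < c)
    (hp : 1 - (p : ℝ) = Real.exp (-(α * c))) :
    HasLaw (fun x : Ω × CellData ↦ (A x.1, x.2))
      ((cellDataLaw α).map fun e ↦ (floorImage c e.config.carrier, e))
      (poissonExtension P hA α c) := by
  refine ⟨by fun_prop, ?_⟩
  rw [← setBernoulli_compProd_cellDataKernel hc hp, ← hAp.map_eq, ← map_prodMap_poissonExtension hA]
  rfl

/-- The pair has the joint law of hit cells and cell data, under which the equality holds by
construction. -/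
theorem ae_floorImage_poissonExtension {p : unitInterval} (hAp : IsSetBernoulli A Set.univ p P) (hc : 0 < c)
    (hp : 1 - (p : ℝ) = Real.exp (-(α * c))) :
    ∀ᵐ x ∂poissonExtension P hA α c, A x.1 = floorImage c x.2.config.carrier := by
  refine ((hasLaw_poissonExtension hA hAp hc hp).ae_iff
    (p := fun y ↦ y.1 = floorImage c y.2.config.carrier)
    (measurableSet_setOfPred.1 (measurableSet_eq_floorImage hc))).2 ?_
  rw [ae_map_iff (measurable_floorImage_prodMk hc).aemeasurable (measurableSet_eq_floorImage hc)]
  exact ae_of_all _ fun _ ↦ rfl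

theorem isPoissonProcess_poissonExtension {p : unitInterval} (hAp : IsSetBernoulli A Set.univ p P) (hc : 0 < c)
    (hp : 1 - (p : ℝ) = Real.exp (-(α * c))) :
    IsPoissonProcess α (fun x : Ω × CellData ↦ x.2.config) (poissonExtension P hA α c) := by
  have hsnd : (poissonExtension P hA α c).map Prod.snd = cellDataLaw α := by
    have h := congrArg (Measure.map Prod.snd) (hasLaw_poissonExtension hA hAp hc hp).map_eq
    rw [Measure.map_map measurable_snd (by fun_prop),
      Measure.map_map measurable_snd (measurable_floorImage_prodMk hc)] at h
    exact h.trans Measure.map_id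
  exact (CellData.isPoissonProcess_config α).comp_hasLaw measurable_snd hsnd

/-- The new data depend on the sample only through `A`, so what is independent of `A` stays
independent of them. -/
theorem indepFun_poissonExtension {β : Type*} [MeasurableSpace β] {Y : Ω → β} (hY : Measurable Y)
    (hAY : IndepFun A Y P) :
    IndepFun (fun x : Ω × CellData ↦ x.2) (fun x ↦ Y x.1) (poissonExtension P hA α c) := by
  rw [indepFun_iff_measure_inter_preimage_eq_mul]
  intro s t hs ht
  have hκ : Measurable fun a ↦ cellDataKernel α c a s := Kernel.measurable_coe _ hs
  have h1 : poissonExtension P hA α c ((fun x ↦ x.2) ⁻¹' s)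
      = ∫⁻ ω, cellDataKernel α c (A ω) s ∂P := by
    rw [poissonExtension, Measure.compProd_apply (measurable_snd hs)]
    rfl
  have h2 : poissonExtension P hA α c ((fun x ↦ Y x.1) ⁻¹' t) = P (Y ⁻¹' t) := by
    conv_rhs => rw [← map_fst_poissonExtension (P := P) hA (α := α) (c := c),
      Measure.map_apply measurable_fst (hY ht)]
    rfl
  have h3 : poissonExtension P hA α c ((fun x ↦ x.2) ⁻¹' s ∩ (fun x ↦ Y x.1) ⁻¹' t)
      = ∫⁻ ω, cellDataKernel α c (A ω) s * t.indicator 1 (Y ω) ∂P := by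
    refine (Measure.compProd_apply
      ((measurable_snd hs).inter ((hY.comp measurable_fst) ht))).trans ?_
    refine lintegral_congr fun ω ↦ ?_
    by_cases hω : Y ω ∈ t
    · simp [Set.preimage, hω]
    · simp [Set.preimage, hω]
  have h4 := lintegral_mul_eq_lintegral_mul_lintegral_of_indepFun (hκ.comp hA)
    (((measurable_one : Measurable (1 : β → ENNReal)).indicator ht).comp hY)
    (hAY.comp hκ ((measurable_one : Measurable (1 : β → ENNReal)).indicator ht))
  rw [h1, h2, h3]
  refine h4.trans ?_
  congr 1
  exact (lintegral_indicator_one (hY ht))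

end

/-! ### From the Poisson statement to the Bernoulli one. -/

theorem BernoulliRoughIsometricAS.of_poisson {α β : ℝ≥0} (hα : 0 < α) (hβ : 0 < β)
    {p q : unitInterval} (hp : 0 < p ∧ p < 1) (hq : 0 < q ∧ q < 1)
    (h : PoissonRoughIsometricAS.{u} α β) : BernoulliRoughIsometricAS.{u} p q := by
  obtain ⟨c, hc, hpc⟩ := exists_one_sub_eq_exp hα hp
  obtain ⟨d, hd, hqd⟩ := exists_one_sub_eq_exp hβ hq
  intro Ω _ P _ A₀ B₀ hA₀ hB₀ hAB₀
  -- Pulling back the kernel requires genuinely measurable maps, so both percolations are replaced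
  -- by measurable versions.
  obtain ⟨A, hAm, hA⟩ := hA₀.aemeasurable
  obtain ⟨B, hBm, hB⟩ := hB₀.aemeasurable
  replace hA₀ := hA₀.congr hA.symm
  replace hB₀ := hB₀.congr hB.symm
  have hAB := hAB₀.congr hA hB
  let Q := poissonExtension P hAm α c
  have hBQ : IsSetBernoulli (fun x : Ω × CellData ↦ B x.1) Set.univ q Q :=
    hB₀.fun_comp ⟨measurable_fst.aemeasurable, map_fst_poissonExtension hAm⟩
  have hBmQ : Measurable fun x : Ω × CellData ↦ B x.1 := hBm.comp measurable_fst
  have hind : IndepFun (fun x : Ω × CellData ↦ B x.1) (fun x ↦ x.2.config) Q :=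
    ((indepFun_poissonExtension hAm hBm hAB).comp CellData.measurable_config measurable_id).symm
  have hApois := isPoissonProcess_poissonExtension hAm hA₀ hc hpc
  -- The second extension is over `B`, which is independent of the first Poisson process; hence so
  -- is the second process.
  let R := poissonExtension Q hBmQ β d
  have hind' : IndepFun (fun x : (Ω × CellData) × CellData ↦ x.1.2.config) (fun x ↦ x.2.config) R :=
    ((indepFun_poissonExtension hBmQ hApois.measurable hind).comp
      CellData.measurable_config measurable_id).symm
  have hBpois := isPoissonProcess_poissonExtension hBmQ hBQ hd hqd
  have hApois' := hApois.comp_hasLaw (f := Prod.fst)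
    measurable_fst (map_fst_poissonExtension (P := Q) hBmQ (α := β) (c := d))
  have hfinal := h _ R _ _ hApois' hBpois hind'
  have hBR := ae_floorImage_poissonExtension hBmQ hBQ hd hqd
  have hAQ := ae_floorImage_poissonExtension hAm hA₀ hc hpc
  -- The claim does not involve the last coordinate, so one good value of it suffices in almost
  -- every fibre.
  have hQ : ∀ᵐ x ∂Q, RoughIsometric x.2.config.carrier (B x.1) := by
    filter_upwards [Measure.ae_ae_of_ae_compProd hfinal, Measure.ae_ae_of_ae_compProd hBR]
      with x hx hx'
    obtain ⟨e, he, he'⟩ := (hx.and hx').exists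
    rw [he']
    exact he.trans (roughIsometric_floorImage hd _)
  filter_upwards [Measure.ae_ae_of_ae_compProd hQ, Measure.ae_ae_of_ae_compProd hAQ, hA, hB]
    with ω h1 h2 h3 h4
  obtain ⟨e, he, he'⟩ := (h1.and h2).exists
  rw [h3, h4, he']
  exact (roughIsometric_floorImage hc _).symm.trans he

theorem proposition2p2 :
    List.TFAE [
      ∃ α β : ℝ≥0, 0 < α ∧ 0 < β ∧ PoissonRoughIsometricAS.{u} α β,
      ∀ α β : ℝ≥0, 0 < α → 0 < β → PoissonRoughIsometricAS.{u} α β,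
      ∃ p q : unitInterval, (0 < p ∧ p < 1) ∧ (0 < q ∧ q < 1) ∧ BernoulliRoughIsometricAS.{u} p q,
      ∀ p q : unitInterval, (0 < p ∧ p < 1) → (0 < q ∧ q < 1) →
        BernoulliRoughIsometricAS.{u} p q] := by
  tfae_have 2 → 1 := fun h ↦ ⟨1, 1, one_pos, one_pos, h 1 1 one_pos one_pos⟩
  tfae_have 1 → 4 := fun ⟨_, _, hα, hβ, h⟩ _ _ hp hq ↦ .of_poisson hα hβ hp hq h
  tfae_have 4 → 3 := fun h ↦ by
    have h2 : (0 : unitInterval) < ⟨1 / 2, by norm_num, by norm_num⟩ ∧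
        (⟨1 / 2, by norm_num, by norm_num⟩ : unitInterval) < 1 :=
      ⟨Subtype.mk_lt_mk.2 (by norm_num), Subtype.mk_lt_mk.2 (by norm_num)⟩
    exact ⟨_, _, h2, h2, h _ _ h2 h2⟩
  tfae_have 3 → 2 := fun ⟨_, _, hp, hq, h⟩ _ _ hα hβ ↦ .of_bernoulli hα hβ hp hq h
  tfae_finish
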